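/- Zero-forcing MIMO broadcast channel with random vector quantization. Let $M\ge 1$; a transmitter with $M$ antennas serves $K=M$ single-antenna users. The channel vectors $\mathbf h_1,\dots,\mathbf h_M\in\mathbb C^M$ are independent with i.i.d. $\mathcal{CN}(0,1)$ entries. For $\mathbf b=(b_1,\dots,b_M)\in\mathbb Z_{\ge0}^M$, user $k$ has a random codebook of $2^{b_k}$ isotropic unit vectors of $\mathbb C^M$, all codewords and channels being independent, and $\hat{\mathbf h}_k$ is the codeword $\mathbf w$ of user $k$ that maximizes $|\mathbf h_k^\dagger\mathbf w|^2$. Let $\hat{\mathbf H}=[\hat{\mathbf h}_1,\dots,\hat{\mathbf h}_M]^\dagger$ and let $\mathbf v_k$ be the normalized $k$-th column of $\hat{\mathbf H}^{-1}$. For path losses $\gamma_1,\dots,\gamma_M\ge0$ and transmit power $P\ge0$, the average rate of user $k$ and the average sum rate are $$\mathcal R^{(k)}(\gamma,P,\mathbf b)=\mathbb E\left[\log_2\left(1+\frac{\frac{\gamma_kP}{M}|\mathbf h_k^\dagger\mathbf v_k|^2}{1+\sum_{i\ne k}\frac{\gamma_kP}{M}|\mathbf h_k^\dagger\mathbf v_i|^2}\right)\right],\qquad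 \mathcal R(\gamma,P,\mathbf b)=\sum_{k=1}^M\mathcal R^{(k)}(\gamma,P,\mathbf b).$$ Write $\tilde{\mathbf h}_k=\mathbf h_k/\|\mathbf h_k\|$, $Q_k=\|\mathbf h_k\|^2$, $X_k=|\tilde{\mathbf h}_k^\dagger\mathbf v_k|^2$, $Z_k=1-|\tilde{\mathbf h}_k^\dagger\hat{\mathbf h}_k|^2$ and $W_k=\sum_{i\ne k}|\mathbf e_k^\dagger\mathbf v_i|^2$, where $\mathbf e_k$ is the normalized component of $\tilde{\mathbf h}_k$ orthogonal to $\hat{\mathbf h}_k$ (with $\mathbf e_k=0$ if that component vanishes). Then all expectations here and below are of integrable functions, and: (1) $\mathcal R^{(k)}(\gamma,P,\mathbf b)$ depends on $\mathbf b$ only through $b_k$: it does not change when the other users' feedback sizes $b_i$, $i\neq k$, change. (2) There is a function $(P,\beta)\mapsto \mathcal R_k(P,\beta)$, the same for all users $k$, such that $$\mathcal R_k(P,b_k)=\mathbb E\left[\log_2\left(1+\frac{\frac PM Q_kX_k}{1+\frac PM Q_kW_kZ_k}\right)\right]=\mathbb E\left[\log_2\left(1+\frac{\frac PM Q_1X_1}{1+\frac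 PM Q_1W_1Z_1}\right)\right],$$ where the first expectation is taken in the system with feedback sizes $\mathbf b$, and the second one in any system in which user 1 has feedback size $b_k$, whatever the feedback sizes of the other users; in both, the expectation is with respect to the joint law of the four variables. (3) If $\gamma_1=\dots=\gamma_M=1$, then $\mathcal R^{(k)}(\gamma,P,\mathbf b)=\mathcal R_k(P,b_k)$ for every $k$, and so $\mathcal R(P,\mathbf b)=\sum_{k=1}^M\mathcal R_k(P,b_k)$. (4) For arbitrary path losses, $\mathcal R^{(k)}(\gamma,P,\mathbf b)=\mathcal R_k(\gamma_kP,b_k)$ for every $k$, and so $\mathcal R(\gamma,P,\mathbf b)=\sum_{k=1}^M\mathcal R_k(\gamma_kP,b_k)$. -/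

import Mathlib

open MeasureTheory ProbabilityTheory
open scoped BigOperators

noncomputable section

namespace ZFMIMO

/-- Column vectors with `M` complex entries and the Hermitian inner product; `inner ℂ x y` is
`x† y`. -/
abbrev Vec (M : ℕ) : Type := EuclideanSpace ℂ (Fin M)

/-- Circularly symmetric complex Gaussian law with mean `0` and variance `1`: independent real and
imaginary parts, each of law `N(0, 1/2)`. -/
def complexGaussian : Measure ℂ :=
  ((gaussianReal 0 (1 / 2)).prod (gaussianReal 0 (1 / 2))).map
    (fun p : ℝ × ℝ => (⟨p.1, p.2⟩ : ℂ))

/-- Law of a channel vector: `M` i.i.d. entries, each standard circularly symmetric Gaussian. -/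
def channelLaw (M : ℕ) : Measure (Vec M) :=
  (Measure.pi (fun _ : Fin M => complexGaussian)).map (WithLp.toLp 2)

/-- `x / ‖x‖` (and `0` for `x = 0`). -/
def normalize {M : ℕ} (x : Vec M) : Vec M := ((‖x‖⁻¹ : ℝ) : ℂ) • x

/-- Law of an isotropic unit vector, i.e. the uniform law on the unit sphere of `ℂ^M`: the law of
the direction of a standard complex Gaussian vector. -/
def isotropicLaw (M : ℕ) : Measure (Vec M) := (channelLaw M).map normalize

/-- The randomness of all `M` users: user `k` has a channel vector and a codebook of `2 ^ b k`
codewords. -/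
abbrev Sample (M : ℕ) (b : Fin M → ℕ) : Type :=
  (k : Fin M) → Vec M × (Fin (2 ^ b k) → Vec M)

/-- All channel vectors and all codewords are independent; the channels are Gaussian and the
codewords are isotropic unit vectors. -/
def law (M : ℕ) (b : Fin M → ℕ) : Measure (Sample M b) :=
  Measure.pi fun k =>
    (channelLaw M).prod (Measure.pi fun _ : Fin (2 ^ b k) => isotropicLaw M)

open Classical in
/-- The indices of the codewords `w` that maximize `|h† w|²`. -/
def maximizers {M n : ℕ} (h : Vec M) (C : Fin n → Vec M) : Finset (Fin n) :=
  Finset.univ.filter fun i => ∀ j, ‖inner ℂ h (C j)‖ ^ 2 ≤ ‖inner ℂ h (C i)‖ ^ 2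

theorem maximizers_nonempty {M n : ℕ} [NeZero n] (h : Vec M) (C : Fin n → Vec M) :
    (maximizers h C).Nonempty := by
  obtain ⟨i, hi⟩ := Finite.exists_max fun i => ‖inner ℂ h (C i)‖ ^ 2
  exact ⟨i, by simpa [maximizers] using hi⟩

/-- The codeword that maximizes `|h† w|²` over the codebook (ties go to the smallest index). -/
def quantize {M n : ℕ} [NeZero n] (h : Vec M) (C : Fin n → Vec M) : Vec M :=
  C ((maximizers h C).min' (maximizers_nonempty h C))

section RandomVariables

variable {M : ℕ} {b : Fin M → ℕ}

/-- The channel vector `h_k`. -/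
def chan (k : Fin M) (ω : Sample M b) : Vec M := (ω k).1

/-- The normalized channel vector `h_k / ‖h_k‖`. -/
def chanDir (k : Fin M) (ω : Sample M b) : Vec M := normalize (chan k ω)

/-- The quantized channel vector of user `k`. -/
def quantChan (k : Fin M) (ω : Sample M b) : Vec M := quantize (ω k).1 (ω k).2

/-- The quantized channel matrix: row `k` is the conjugate transpose of the quantized channel
vector of user `k`. -/
def quantMatrix (ω : Sample M b) : Matrix (Fin M) (Fin M) ℂ :=
  Matrix.of fun k j => star (quantChan k ω j)

/-- The zero-forcing beamforming vector of user `k`: the normalized `k`-th column of the inverse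
of the quantized channel matrix. -/
def beam (k : Fin M) (ω : Sample M b) : Vec M :=
  normalize (WithLp.toLp 2 fun j => (quantMatrix ω)⁻¹ j k)

/-- Instantaneous rate of user `k` at path loss `g` and transmit power `P`, with power `P / M` for
each user and the interference of the other streams treated as noise. -/
def instRate (g P : ℝ) (k : Fin M) (ω : Sample M b) : ℝ :=
  Real.logb 2 (1 + (g * P / M) * ‖inner ℂ (chan k ω) (beam k ω)‖ ^ 2 /
    (1 + ∑ i ∈ Finset.univ.erase k, (g * P / M) * ‖inner ℂ (chan k ω) (beam i ω)‖ ^ 2))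

/-- Channel gain `Q_k = ‖h_k‖²`. -/
def Q (k : Fin M) (ω : Sample M b) : ℝ := ‖chan k ω‖ ^ 2

/-- `X_k`, the squared inner product of the channel direction and the own beamforming vector. -/
def X (k : Fin M) (ω : Sample M b) : ℝ := ‖inner ℂ (chanDir k ω) (beam k ω)‖ ^ 2

/-- Quantization error `Z_k`. -/
def Z (k : Fin M) (ω : Sample M b) : ℝ := 1 - ‖inner ℂ (chanDir k ω) (quantChan k ω)‖ ^ 2

/-- Direction `e_k` of the quantization error: the normalized component of the channel direction
orthogonal to the quantized channel vector. -/
def errDir (k : Fin M) (ω : Sample M b) : Vec M :=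
  normalize (chanDir k ω - inner ℂ (quantChan k ω) (chanDir k ω) • quantChan k ω)

/-- `W_k`, the sum over `i ≠ k` of `|e_k† v_i|²`. -/
def W (k : Fin M) (ω : Sample M b) : ℝ :=
  ∑ i ∈ Finset.univ.erase k, ‖inner ℂ (errDir k ω) (beam i ω)‖ ^ 2

/-- `log₂ (1 + (P/M) Q_k X_k / (1 + (P/M) Q_k W_k Z_k))`. -/
def reducedRate (P : ℝ) (k : Fin M) (ω : Sample M b) : ℝ :=
  Real.logb 2 (1 + (P / M) * Q k ω * X k ω / (1 + (P / M) * Q k ω * W k ω * Z k ω))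

end RandomVariables

/-- Average rate of user `k` with path losses `γ`, power `P` and feedback sizes `b`. -/
def userRate {M : ℕ} (γ : Fin M → ℝ) (P : ℝ) (b : Fin M → ℕ) (k : Fin M) : ℝ :=
  ∫ ω, instRate (γ k) P k ω ∂(law M b)

/-- Average sum rate with path losses `γ`, power `P` and feedback sizes `b`. -/
def sumRate {M : ℕ} (γ : Fin M → ℝ) (P : ℝ) (b : Fin M → ℕ) : ℝ :=
  ∑ k, userRate γ P b k

end ZFMIMO

end

noncomputable section

namespace ZFMIMO

/-! The Gaussian and isotropic laws are unitarily invariant, and the quantizer commutes with unitary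
maps. Hence every quantized channel is isotropic whatever its codebook size
(`userLaw_map_quantize`), because the isotropic law is the only unitarily invariant probability on
the sphere (`eq_isotropicLaw`). The rate of user `k` involves the other users only through their
quantized channels, so it sees only `b k` (`law_map_reduce`). Relabelling users permutes the rows of
the quantized matrix and the beams alike, so all users share one rate function.

For the reduced variables, split the channel direction along and across the quantized channel:
zero-forcing kills the first part for every other beam, which leaves `Q W Z` as interference
(`norm_inner_chan_beam_sq`). Path loss and power enter only through their product. Integrability
follows from `log (1 + x) ≤ x` and the second moment of the channel. -/

theorem measurable_complex_mk : Measurable (fun p : ℝ × ℝ => (⟨p.1, p.2⟩ : ℂ)) :=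
  Complex.measurableEquivRealProd.symm.measurable

instance : IsProbabilityMeasure complexGaussian :=
  Measure.isProbabilityMeasure_map measurable_complex_mk.aemeasurable

instance (M : ℕ) : IsProbabilityMeasure (channelLaw M) :=
  Measure.isProbabilityMeasure_map (by fun_prop)

theorem measurable_normalize {M : ℕ} : Measurable (normalize (M := M)) := by
  unfold normalize
  fun_prop

instance (M : ℕ) : IsProbabilityMeasure (isotropicLaw M) :=
  Measure.isProbabilityMeasure_map measurable_normalize.aemeasurable

instance (M : ℕ) (b : Fin M → ℕ) : IsProbabilityMeasure (law M b) := by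
  unfold law
  infer_instance

/-! ### Unitary invariance and moments of the channel and codeword laws -/

theorem charFun_complexGaussian (t : ℂ) :
    charFun complexGaussian t = Complex.exp (-(‖t‖ ^ 2 / 4 : ℝ)) := by
  have h1 (p : ℝ × ℝ) : Complex.exp ((inner ℝ (⟨p.1, p.2⟩ : ℂ) t : ℝ) * Complex.I)
      = Complex.exp ((inner ℝ p.1 t.re : ℝ) * Complex.I)
        * Complex.exp ((inner ℝ p.2 t.im : ℝ) * Complex.I) := by
    rw [← Complex.exp_add, ← add_mul, ← Complex.ofReal_add]
    congr 3
    simp [Complex.inner]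
  rw [charFun_apply, complexGaussian, integral_map measurable_complex_mk.aemeasurable
    (by fun_prop)]
  simp_rw [h1]
  rw [integral_prod_mul (fun x : ℝ => Complex.exp ((inner ℝ x t.re : ℝ) * Complex.I))
    (fun y : ℝ => Complex.exp ((inner ℝ y t.im : ℝ) * Complex.I)), ← charFun_apply,
    ← charFun_apply, charFun_gaussianReal, charFun_gaussianReal, ← Complex.exp_add]
  congr 1
  rw [Complex.sq_norm, Complex.normSq_apply]
  push_cast
  ring

theorem charFun_channelLaw {M : ℕ} (t : Vec M) :
    charFun (channelLaw M) t = Complex.exp (-(‖t‖ ^ 2 / 4 : ℝ)) := by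
  rw [channelLaw, charFun_pi]
  simp_rw [charFun_complexGaussian]
  rw [← Complex.exp_sum, EuclideanSpace.norm_sq_eq]
  congr 1
  push_cast
  rw [Finset.sum_neg_distrib, Finset.sum_div]

/-- Polarization. The real inner product is the one inside `charFun`, while `U` is a complex
isometry. -/
theorem real_inner_isometry {M : ℕ} (U : Vec M ≃ₗᵢ[ℂ] Vec M) (x y : Vec M) :
    inner ℝ (U x) (U y) = inner ℝ x y := by
  simp_rw [real_inner_eq_norm_mul_self_add_norm_mul_self_sub_norm_sub_mul_self_div_two, ← map_sub,
    U.norm_map]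

theorem charFun_map_isometry {M : ℕ} (μ : Measure (Vec M)) (U : Vec M ≃ₗᵢ[ℂ] Vec M)
    (t : Vec M) : charFun (μ.map U) (U t) = charFun μ t := by
  rw [charFun_apply, charFun_apply, integral_map (by fun_prop) (by fun_prop)]
  simp_rw [real_inner_isometry]

/-- A linear isometry that preserves the characteristic function preserves the measure. -/
theorem map_isometry_eq_self {M : ℕ} {μ : Measure (Vec M)} [IsFiniteMeasure μ]
    (U : Vec M ≃ₗᵢ[ℂ] Vec M) (h : ∀ t, charFun μ (U t) = charFun μ t) :
    μ.map U = μ := by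
  apply Measure.ext_of_charFun (E := Vec M)
  ext t
  obtain ⟨s, rfl⟩ := U.surjective t
  rw [h s, charFun_map_isometry]

theorem channelLaw_map_isometry {M : ℕ} (U : Vec M ≃ₗᵢ[ℂ] Vec M) :
    (channelLaw M).map U = channelLaw M :=
  map_isometry_eq_self U fun t => by simp [charFun_channelLaw]

theorem normalize_isometry {M : ℕ} (U : Vec M ≃ₗᵢ[ℂ] Vec M) (x : Vec M) :
    normalize (U x) = U (normalize x) := by
  simp [normalize]

theorem isotropicLaw_map_isometry {M : ℕ} (U : Vec M ≃ₗᵢ[ℂ] Vec M) :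
    (isotropicLaw M).map U = isotropicLaw M := by
  have hU : Measurable U := U.continuous.measurable
  conv_rhs => rw [isotropicLaw, ← channelLaw_map_isometry U,
    Measure.map_map measurable_normalize hU]
  rw [isotropicLaw, Measure.map_map hU measurable_normalize]
  congr 1
  ext1 x
  exact (normalize_isometry U x).symm

theorem norm_normalize_of_ne_zero {M : ℕ} {x : Vec M} (hx : x ≠ 0) : ‖normalize x‖ = 1 := by
  have : ‖x‖ ≠ 0 := norm_ne_zero_iff.2 hx
  simp [normalize, norm_smul, this]

theorem norm_normalize_le_one {M : ℕ} (x : Vec M) : ‖normalize x‖ ≤ 1 := by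
  rcases eq_or_ne x 0 with rfl | hx
  · simp [normalize]
  · exact (norm_normalize_of_ne_zero hx).le

theorem complexGaussian_singleton (z : ℂ) : complexGaussian {z} = 0 := by
  rw [complexGaussian, Measure.map_apply measurable_complex_mk (measurableSet_singleton z)]
  have : (fun p : ℝ × ℝ => (⟨p.1, p.2⟩ : ℂ)) ⁻¹' {z} = {z.re} ×ˢ {z.im} := by
    ext p
    simp [Complex.ext_iff, Prod.ext_iff]
  have h0 : NullSingletonClass (gaussianReal 0 (1 / 2)) :=
    nullSingletonClass_gaussianReal (by norm_num)
  rw [this, Measure.prod_prod, measure_singleton, zero_mul]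

theorem channelLaw_ae_ne_zero (M : ℕ) [NeZero M] : ∀ᵐ x ∂channelLaw M, x ≠ 0 := by
  rw [channelLaw, ae_map_iff (p := fun x : Vec M => x ≠ 0) (by fun_prop)
    (measurableSet_singleton _).compl]
  -- A single entry that is almost surely nonzero suffices; it exists since `M ≠ 0`.
  have := Measure.tendsto_eval_ae_ae (μ := fun _ : Fin M => complexGaussian) (i := 0)
    |>.eventually (p := fun z => z ≠ 0) (compl_mem_ae_iff.2 (complexGaussian_singleton 0))
  filter_upwards [this] with x hx h0
  exact hx (by simpa using congrArg (fun v : Vec M => v 0) h0)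

theorem isotropicLaw_ae_norm (M : ℕ) [NeZero M] : ∀ᵐ x ∂isotropicLaw M, ‖x‖ = 1 := by
  rw [isotropicLaw, ae_map_iff measurable_normalize.aemeasurable
    (measurableSet_eq_fun (by fun_prop) (by fun_prop))]
  filter_upwards [channelLaw_ae_ne_zero M] with x hx using norm_normalize_of_ne_zero hx

theorem channelLaw_eq_map_stdGaussian (M : ℕ) :
    channelLaw M = (stdGaussian (Vec M)).map (fun x => (√2)⁻¹ • x) := by
  apply Measure.ext_of_charFun (E := Vec M)
  ext t
  rw [charFun_channelLaw, charFun_map_smul, charFun_stdGaussian, norm_smul]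
  congr 1
  rw [Real.norm_of_nonneg (by positivity), ← Complex.ofReal_pow, mul_pow, inv_pow,
    Real.sq_sqrt (by norm_num)]
  push_cast
  ring

theorem integrable_norm_sq_channelLaw (M : ℕ) :
    Integrable (fun x : Vec M => ‖x‖ ^ 2) (channelLaw M) := by
  have h : MemLp (fun x : Vec M => (√2)⁻¹ • x) 2 (stdGaussian (Vec M)) := by
    simpa [Pi.smul_def] using (IsGaussian.memLp_two_id (μ := stdGaussian (Vec M))).const_smul (√2)⁻¹
  rw [channelLaw_eq_map_stdGaussian, integrable_map_measure (by fun_prop) (by fun_prop)]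
  exact h.integrable_norm_pow (by norm_num)

/-! ### Uniqueness of the isotropic law -/

/-- The group of unitary maps acts transitively on spheres. -/
theorem exists_isometry_map_eq {M : ℕ} {x y : Vec M} (h : ‖x‖ = ‖y‖) :
    ∃ U : Vec M ≃ₗᵢ[ℂ] Vec M, U x = y := by
  rcases eq_or_ne x 0 with rfl | hx
  · exact ⟨.refl ℂ _, (norm_eq_zero.1 (by simpa using h.symm)).symm⟩
  have hx' : ‖x‖ ≠ 0 := norm_ne_zero_iff.2 hx
  let e := LinearEquiv.toSpanNonzeroSingleton ℂ (Vec M) x hx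
  let f : ℂ ∙ x →ₗ[ℂ] Vec M := (LinearMap.toSpanSingleton ℂ (Vec M) y) ∘ₗ e.symm.toLinearMap
  have hf (c : ℂ) : f (e c) = c • y := by simp [f]
  -- The map `c • x ↦ c • y` is isometric on the line through `x`, and extends to an isometry of the
  -- whole space.
  let L : ℂ ∙ x →ₗᵢ[ℂ] Vec M :=
    { f with
      norm_map' := fun v => by
        obtain ⟨c, rfl⟩ := e.surjective v
        change ‖f (e c)‖ = _
        rw [hf, norm_smul, ← h, ← norm_smul]
        rfl }
  refine ⟨L.extend.toLinearIsometryEquiv rfl, ?_⟩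
  have h1 : ((e 1 : ℂ ∙ x) : Vec M) = x := by simp [e]
  have h2 : L.extend (e 1 : ℂ ∙ x) = L (e 1) := L.extend_apply (e 1)
  rw [h1] at h2
  have h3 : L (e 1) = y := by
    change f (e 1) = y
    rw [hf, one_smul]
  simpa [h3] using h2

/-- A unitarily invariant probability measure on the unit sphere is the isotropic law. -/
theorem eq_isotropicLaw {M : ℕ} [NeZero M] {μ : Measure (Vec M)} [IsProbabilityMeasure μ]
    (hinv : ∀ U : Vec M ≃ₗᵢ[ℂ] Vec M, μ.map U = μ) (hnorm : ∀ᵐ x ∂μ, ‖x‖ = 1) :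
    μ = isotropicLaw M := by
  have radial {ν : Measure (Vec M)} (hν : ∀ U : Vec M ≃ₗᵢ[ℂ] Vec M, ν.map U = ν) {s t : Vec M}
      (hst : ‖s‖ = ‖t‖) : charFun ν s = charFun ν t := by
    obtain ⟨U, rfl⟩ := exists_isometry_map_eq hst.symm
    simpa only [hν U] using charFun_map_isometry ν U t
  -- By invariance, `charFun ν t` equals `charFun ν (‖t‖ • u)` for every unit vector `u`. Averaging
  -- over `u` gives a double integral in which `ν` and `ν'` play symmetric roles, so Fubini
  -- identifies the two characteristic functions.
  have key {ν ν' : Measure (Vec M)} [IsProbabilityMeasure ν] [IsProbabilityMeasure ν']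
      (hν : ∀ U : Vec M ≃ₗᵢ[ℂ] Vec M, ν.map U = ν)
      (hn' : ∀ᵐ x ∂ν', ‖x‖ = 1) (t : Vec M) :
      charFun ν t = ∫ u, ∫ x, Complex.exp ((‖t‖ * inner ℝ x u : ℝ) * Complex.I) ∂ν ∂ν' := by
    have h1 : ∀ᵐ u ∂ν', (∫ x, Complex.exp ((‖t‖ * inner ℝ x u : ℝ) * Complex.I) ∂ν)
        = charFun ν t := by
      filter_upwards [hn'] with u hu
      rw [← radial hν (s := ‖t‖ • u) (t := t) (by simp [norm_smul, hu]), charFun_apply]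
      simp_rw [real_inner_smul_right]
    rw [integral_congr_ae h1]
    simp
  apply Measure.ext_of_charFun (E := Vec M)
  ext t
  rw [key hinv (isotropicLaw_ae_norm M) t, key isotropicLaw_map_isometry hnorm t,
    integral_integral_swap]
  · simp_rw [real_inner_comm]
  · refine (integrable_const (1 : ℝ)).mono' (Measurable.aestronglyMeasurable ?_) ?_
    · simp only [Function.uncurry_def]
      fun_prop
    · exact Filter.Eventually.of_forall fun p => by
        simp only [Function.uncurry_def]
        rw [Complex.norm_exp_ofReal_mul_I]

/-! ### The quantizer and the law of its output -/

theorem mem_maximizers {M n : ℕ} {h : Vec M} {C : Fin n → Vec M} {i : Fin n} :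
    i ∈ maximizers h C ↔ ∀ j, ‖inner ℂ h (C j)‖ ^ 2 ≤ ‖inner ℂ h (C i)‖ ^ 2 := by
  simp [maximizers]

theorem quantize_mem_range {M n : ℕ} [NeZero n] (h : Vec M) (C : Fin n → Vec M) :
    ∃ i, quantize h C = C i :=
  ⟨_, rfl⟩

theorem measurableSet_mem_maximizers {M n : ℕ} (i : Fin n) :
    MeasurableSet {p : Vec M × (Fin n → Vec M) | i ∈ maximizers p.1 p.2} := by
  simp_rw [mem_maximizers, Set.ofPred_forall]
  exact MeasurableSet.iInter fun j => measurableSet_le (by fun_prop) (by fun_prop)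

theorem measurable_quantize {M n : ℕ} [NeZero n] :
    Measurable (fun p : Vec M × (Fin n → Vec M) => quantize p.1 p.2) := by
  have hidx : Measurable (fun p : Vec M × (Fin n → Vec M) =>
      (maximizers p.1 p.2).min' (maximizers_nonempty p.1 p.2)) := by
    refine measurable_to_countable' fun i => ?_
    -- The index `i` is selected iff it is a maximizer and no smaller index is.
    have : (fun p : Vec M × (Fin n → Vec M) =>
        (maximizers p.1 p.2).min' (maximizers_nonempty p.1 p.2)) ⁻¹' {i} =
        {p | i ∈ maximizers p.1 p.2} ∩ ⋂ j, ⋂ (_ : j < i), {p | j ∈ maximizers p.1 p.2}ᶜ := by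
      ext p
      simp only [Set.mem_preimage, Set.mem_singleton_iff, Set.mem_inter_iff, Set.mem_ofPred_eq,
        Set.mem_iInter, Set.mem_compl_iff]
      constructor
      · rintro rfl
        exact ⟨Finset.min'_mem _ _, fun j hj hmem => (Finset.min'_le _ _ hmem).not_gt hj⟩
      · rintro ⟨hi, hlt⟩
        refine le_antisymm (Finset.min'_le _ _ hi) (not_lt.1 fun hh => ?_)
        exact hlt _ hh (Finset.min'_mem _ _)
    rw [this]
    exact (measurableSet_mem_maximizers i).inter <| MeasurableSet.iInter fun j =>
      MeasurableSet.iInter fun _ => (measurableSet_mem_maximizers j).compl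
  have heval : Measurable (fun q : (Vec M × (Fin n → Vec M)) × Fin n => q.1.2 q.2) :=
    measurable_from_prod_countable_left fun i => (measurable_pi_apply i).comp measurable_snd
  exact heval.comp (measurable_id.prodMk hidx)

/-- The selection reads only inner products, so even the tie-breaking is unchanged by `U`. -/
theorem quantize_isometry {M n : ℕ} [NeZero n] (U : Vec M ≃ₗᵢ[ℂ] Vec M) (h : Vec M)
    (C : Fin n → Vec M) : quantize (U h) (fun i => U (C i)) = U (quantize h C) := by
  have : maximizers (U h) (fun i => U (C i)) = maximizers h C := by
    ext i
    simp [mem_maximizers, U.inner_map_map]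
  simp [quantize, this]

/-- Joint law of the channel and of the codebook of a user with `n` codewords. -/
def userLaw (M n : ℕ) : Measure (Vec M × (Fin n → Vec M)) :=
  (channelLaw M).prod (Measure.pi fun _ => isotropicLaw M)

instance (M n : ℕ) : IsProbabilityMeasure (userLaw M n) := by
  unfold userLaw
  infer_instance

theorem measurePreserving_fst_userLaw (M n : ℕ) :
    MeasurePreserving Prod.fst (userLaw M n) (channelLaw M) :=
  measurePreserving_fst

theorem userLaw_map_isometry {M n : ℕ} (U : Vec M ≃ₗᵢ[ℂ] Vec M) :
    (userLaw M n).map (fun p => (U p.1, fun i => U (p.2 i))) = userLaw M n := by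
  have hU : Measurable U := U.continuous.measurable
  have hpi : (Measure.pi fun _ : Fin n => isotropicLaw M).map (fun C i => U (C i))
      = Measure.pi fun _ : Fin n => isotropicLaw M := by
    have : ∀ _ : Fin n, SigmaFinite ((isotropicLaw M).map U) := fun _ => by
      rw [isotropicLaw_map_isometry]
      infer_instance
    rw [Measure.pi_map_pi (f := fun _ => U) fun _ => hU.aemeasurable]
    simp_rw [isotropicLaw_map_isometry]
  have := Measure.map_prod_map (channelLaw M) (Measure.pi fun _ : Fin n => isotropicLaw M) hU
    (g := fun C i => U (C i)) (by fun_prop)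
  rw [channelLaw_map_isometry, hpi] at this
  exact this.symm

theorem userLaw_ae_norm_quantize (M n : ℕ) [NeZero M] [NeZero n] :
    ∀ᵐ p ∂userLaw M n, ‖quantize p.1 p.2‖ = 1 := by
  have h : ∀ᵐ C ∂(Measure.pi fun _ : Fin n => isotropicLaw M), ∀ i, ‖C i‖ = 1 :=
    Filter.eventually_all.2 fun i =>
      (Measure.tendsto_eval_ae_ae (μ := fun _ : Fin n => isotropicLaw M) (i := i)).eventually
        (isotropicLaw_ae_norm M)
  filter_upwards [Measure.quasiMeasurePreserving_snd.ae h] with p hp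
  obtain ⟨i, hi⟩ := quantize_mem_range p.1 p.2
  rw [hi, hp i]

/-- The quantized channel is isotropic, whatever the size of the codebook. -/
theorem userLaw_map_quantize (M n : ℕ) [NeZero M] [NeZero n] :
    (userLaw M n).map (fun p => quantize p.1 p.2) = isotropicLaw M := by
  have hq : Measurable (fun p : Vec M × (Fin n → Vec M) => quantize p.1 p.2) := measurable_quantize
  have : IsProbabilityMeasure ((userLaw M n).map (fun p => quantize p.1 p.2)) :=
    Measure.isProbabilityMeasure_map hq.aemeasurable
  apply eq_isotropicLaw
  · intro U
    have hU : Measurable U := U.continuous.measurable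
    -- Rotating channel and codebook together preserves their joint law and rotates the output.
    conv_rhs => rw [← userLaw_map_isometry U, Measure.map_map hq (by fun_prop)]
    rw [Measure.map_map hU hq]
    congr 1
    ext1 p
    exact (quantize_isometry U p.1 p.2).symm
  · rw [ae_map_iff hq.aemeasurable (measurableSet_eq_fun (by fun_prop) (by fun_prop))]
    exact userLaw_ae_norm_quantize M n

theorem law_eq_pi_userLaw (M : ℕ) (b : Fin M → ℕ) :
    law M b = Measure.pi fun k => userLaw M (2 ^ b k) := rfl

theorem law_ae_norm_quantChan {M : ℕ} [NeZero M] (b : Fin M → ℕ) (k : Fin M) :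
    ∀ᵐ ω ∂law M b, ‖quantChan k ω‖ = 1 :=
  (measurePreserving_eval (μ := fun i => userLaw M (2 ^ b i)) k).quasiMeasurePreserving.ae
    (userLaw_ae_norm_quantize M (2 ^ b k))

/-! ### Rates as functions of the channel of one user and of all quantized channels -/

/-- The beamforming vectors determined by the quantized channels. -/
def beamOf {M : ℕ} (w : Fin M → Vec M) (i : Fin M) : Vec M :=
  normalize (WithLp.toLp 2 fun j => (Matrix.of fun k j => star (w k j))⁻¹ j i)

/-- The instantaneous rate as a function of the channel and of the quantized channels. -/
def rateOf {M : ℕ} (a : ℝ) (k : Fin M) (h : Vec M) (w : Fin M → Vec M) : ℝ :=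
  Real.logb 2 (1 + a * ‖inner ℂ h (beamOf w k)‖ ^ 2 /
    (1 + ∑ i ∈ Finset.univ.erase k, a * ‖inner ℂ h (beamOf w i)‖ ^ 2))

theorem instRate_eq_rateOf {M : ℕ} {b : Fin M → ℕ} (g P : ℝ) (k : Fin M) (ω : Sample M b) :
    instRate g P k ω = rateOf (g * P / M) k (chan k ω) (fun i => quantChan i ω) := rfl

theorem measurable_beamOf {M : ℕ} (i : Fin M) :
    Measurable (fun w : Fin M → Vec M => beamOf w i) := by
  have hentry (k j : Fin M) : Measurable (fun w : Fin M → Vec M => star (w k j)) :=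
    continuous_star.measurable.comp (by fun_prop)
  have hdet (A : (Fin M → Vec M) → Matrix (Fin M) (Fin M) ℂ)
      (hA : ∀ k j, Measurable fun w => A w k j) : Measurable fun w => (A w).det := by
    simp_rw [Matrix.det_apply']
    fun_prop
  refine measurable_normalize.comp ((WithLp.measurable_toLp 2 _).comp
    (measurable_pi_lambda _ fun j => ?_))
  -- Entries of the inverse are ratios of determinants; a singular matrix has inverse `0`,
  -- consistent with `0⁻¹ = 0`.
  simp only [Matrix.inv_def, Matrix.smul_apply, Ring.inverse_eq_inv', smul_eq_mul,
    Matrix.adjugate_apply]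
  refine (hdet _ hentry).inv.mul (hdet _ fun k l => ?_)
  by_cases hk : k = i
  · subst hk
    simp
  · simpa [Matrix.updateRow_ne hk] using hentry k l

theorem measurable_rateOf {M : ℕ} (a : ℝ) (k : Fin M) :
    Measurable (fun p : Vec M × (Fin M → Vec M) => rateOf a k p.1 p.2) := by
  have hb (i : Fin M) : Measurable (fun p : Vec M × (Fin M → Vec M) => beamOf p.2 i) :=
    (measurable_beamOf i).comp measurable_snd
  unfold rateOf Real.logb
  fun_prop

theorem norm_beamOf_le_one {M : ℕ} (w : Fin M → Vec M) (i : Fin M) : ‖beamOf w i‖ ≤ 1 :=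
  norm_normalize_le_one _

/-- Drop the interference, bound the beam by norm one, and use `log (1 + x) ≤ x`. -/
theorem abs_rateOf_le {M : ℕ} {a : ℝ} (ha : 0 ≤ a) (k : Fin M) (h : Vec M) (w : Fin M → Vec M) :
    |rateOf a k h w| ≤ a / Real.log 2 * ‖h‖ ^ 2 := by
  have hS : 0 ≤ ∑ i ∈ Finset.univ.erase k, a * ‖inner ℂ h (beamOf w i)‖ ^ 2 :=
    Finset.sum_nonneg fun i _ => by positivity
  set S := ∑ i ∈ Finset.univ.erase k, a * ‖inner ℂ h (beamOf w i)‖ ^ 2 with hSdef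
  have hin : ‖inner ℂ h (beamOf w k)‖ ≤ ‖h‖ :=
    (norm_inner_le_norm _ _).trans
      (mul_le_of_le_one_right (norm_nonneg _) (norm_beamOf_le_one w k))
  have hx0 : 0 ≤ a * ‖inner ℂ h (beamOf w k)‖ ^ 2 / (1 + S) := by positivity
  have hx1 : a * ‖inner ℂ h (beamOf w k)‖ ^ 2 / (1 + S) ≤ a * ‖h‖ ^ 2 :=
    (div_le_self (by positivity) (by linarith)).trans (by gcongr)
  have hlog2 : 0 < Real.log 2 := Real.log_pos one_lt_two
  rw [rateOf, ← hSdef, abs_of_nonneg (Real.logb_nonneg one_lt_two (by linarith)), Real.logb,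
    div_mul_eq_mul_div]
  gcongr
  exact (Real.log_le_sub_one_of_pos (by linarith)).trans (by linarith)

theorem measurable_chan_quantChan {M : ℕ} {b : Fin M → ℕ} (k : Fin M) :
    Measurable (fun ω : Sample M b => (chan k ω, fun i => quantChan i ω)) := by
  refine Measurable.prodMk ((measurable_pi_apply k).fst) (measurable_pi_lambda _ fun i => ?_)
  exact measurable_quantize.comp (measurable_pi_apply i)

theorem integrable_instRate {M : ℕ} {g P : ℝ} (hg : 0 ≤ g) (hP : 0 ≤ P) (b : Fin M → ℕ)
    (k : Fin M) : Integrable (instRate g P k) (law M b) := by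
  have hint : Integrable (fun ω : Sample M b => g * P / M / Real.log 2 * ‖chan k ω‖ ^ 2)
      (law M b) := by
    refine Integrable.const_mul ?_ _
    have h1 : MeasurePreserving (fun ω : Sample M b => chan k ω) (law M b) (channelLaw M) :=
      (measurePreserving_fst_userLaw M (2 ^ b k)).comp
        (measurePreserving_eval (μ := fun i => userLaw M (2 ^ b i)) k)
    exact h1.integrable_comp_of_integrable (integrable_norm_sq_channelLaw M)
  refine hint.mono' ?_ (Filter.Eventually.of_forall fun ω => ?_)
  · exact ((measurable_rateOf (g * P / M) k).comp
      (measurable_chan_quantChan k)).aestronglyMeasurable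
  · rw [Real.norm_eq_abs, instRate_eq_rateOf]
    exact abs_rateOf_le (by positivity) k _ _

/-! ### The rate of a user depends on its own feedback size only -/

/-- Law of the channel and the quantized channel of a user of interest with `n` codewords,
all other users having isotropic quantized channels (and a dummy channel). -/
def reducedLaw (M n : ℕ) [NeZero n] (k : Fin M) : Measure (Fin M → Vec M × Vec M) :=
  Measure.pi fun i => if i = k then (userLaw M n).map (fun p => (p.1, quantize p.1 p.2))
    else (Measure.dirac 0).prod (isotropicLaw M)

theorem measurable_mk_quantize {M n : ℕ} [NeZero n] :
    Measurable (fun p : Vec M × (Fin n → Vec M) => (p.1, quantize p.1 p.2)) :=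
  measurable_fst.prodMk measurable_quantize

theorem reducedLaw_factor_isProbability {M n : ℕ} [NeZero n] (k i : Fin M) :
    IsProbabilityMeasure (if i = k then (userLaw M n).map (fun p => (p.1, quantize p.1 p.2))
      else (Measure.dirac 0).prod (isotropicLaw M)) := by
  split_ifs
  · exact Measure.isProbabilityMeasure_map measurable_mk_quantize.aemeasurable
  · infer_instance

/-- The map acts coordinatewise, so the product law is pushed forward factor by factor. The channels
of the other users are erased because only the marginal law of a quantized channel, not its joint
law with the channel, is independent of the codebook size. -/
theorem law_map_reduce {M : ℕ} [NeZero M] (b : Fin M → ℕ) (k : Fin M) :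
    (law M b).map (fun ω i => (if i = k then chan i ω else 0, quantChan i ω))
      = reducedLaw M (2 ^ b k) k := by
  let f (i : Fin M) (p : Vec M × (Fin (2 ^ b i) → Vec M)) : Vec M × Vec M :=
    (if i = k then p.1 else 0, quantize p.1 p.2)
  have hf (i : Fin M) : Measurable (f i) := by
    refine Measurable.prodMk ?_ measurable_quantize
    split_ifs
    · exact measurable_fst
    · exact measurable_const
  have hfac (i : Fin M) : (userLaw M (2 ^ b i)).map (f i) =
      if i = k then (userLaw M (2 ^ b k)).map (fun p => (p.1, quantize p.1 p.2))
        else (Measure.dirac 0).prod (isotropicLaw M) := by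
    by_cases hik : i = k
    · subst hik
      simp [f]
    · simp only [f, if_neg hik]
      rw [Measure.dirac_prod, ← userLaw_map_quantize M (2 ^ b i),
        Measure.map_map measurable_prodMk_left measurable_quantize]
      rfl
  have : ∀ i, IsProbabilityMeasure ((userLaw M (2 ^ b i)).map (f i)) := fun i =>
    Measure.isProbabilityMeasure_map (hf i).aemeasurable
  rw [law_eq_pi_userLaw]
  refine (Measure.pi_map_pi fun i => (hf i).aemeasurable).trans ?_
  simp_rw [hfac]
  rfl

/-- The rate of a user at path loss `g` as an integral that sees only its own feedback size. -/
theorem integral_instRate {M : ℕ} [NeZero M] (g P : ℝ) (b : Fin M → ℕ) (k : Fin M) :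
    ∫ ω, instRate g P k ω ∂law M b =
      ∫ x, rateOf (g * P / M) k (x k).1 (fun i => (x i).2) ∂reducedLaw M (2 ^ b k) k := by
  have hm : Measurable (fun (ω : Sample M b) i =>
      ((if i = k then chan i ω else 0, quantChan i ω) : Vec M × Vec M)) := by
    refine measurable_pi_lambda _ fun i => Measurable.prodMk ?_ ?_
    · split_ifs
      · exact (measurable_pi_apply i).fst
      · exact measurable_const
    · exact measurable_quantize.comp (measurable_pi_apply i)
  rw [← law_map_reduce b k, integral_map hm.aemeasurable]
  · simp [instRate_eq_rateOf]
  · exact ((measurable_rateOf (g * P / M) k).comp (by fun_prop :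
      Measurable fun x : Fin M → Vec M × Vec M => ((x k).1, fun i => (x i).2))).aestronglyMeasurable

/-! ### Exchangeability of the users -/

/-- Permuting the rows of a matrix permutes the columns of its inverse. -/
theorem beamOf_comp_equiv {M : ℕ} (e : Equiv.Perm (Fin M)) (w : Fin M → Vec M) (i : Fin M) :
    beamOf (fun j => w (e j)) i = beamOf w (e i) := by
  have := Matrix.inv_submatrix_equiv (Matrix.of fun k j => star (w k j)) e (Equiv.refl _)
  unfold beamOf
  congr 2
  ext j
  exact congrFun (congrFun this j) i

theorem rateOf_comp_equiv {M : ℕ} (e : Equiv.Perm (Fin M)) (a : ℝ) (k : Fin M) (h : Vec M)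
    (w : Fin M → Vec M) : rateOf a k h (fun j => w (e j)) = rateOf a (e k) h w := by
  have hsum : ∑ i ∈ Finset.univ.erase k, a * ‖inner ℂ h (beamOf w (e i))‖ ^ 2 =
      ∑ i ∈ Finset.univ.erase (e k), a * ‖inner ℂ h (beamOf w i)‖ ^ 2 :=
    Finset.sum_equiv e (by simp) fun _ _ => rfl
  simp only [rateOf, beamOf_comp_equiv, hsum]

/-- The factors of `reducedLaw` at users other than the distinguished one coincide, so a relabelling
only moves the distinguished user. -/
theorem integral_rateOf_reducedLaw_perm {M n : ℕ} [NeZero n] (e : Equiv.Perm (Fin M)) (a : ℝ)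
    (k : Fin M) :
    ∫ x, rateOf a k (x k).1 (fun i => (x i).2) ∂reducedLaw M n k =
      ∫ x, rateOf a (e k) (x (e k)).1 (fun i => (x i).2) ∂reducedLaw M n (e k) := by
  have : ∀ i, IsProbabilityMeasure (if i = e k then
      (userLaw M n).map (fun p => (p.1, quantize p.1 p.2))
      else (Measure.dirac 0).prod (isotropicLaw M)) := reducedLaw_factor_isProbability (e k)
  have hmp := measurePreserving_piCongrLeft (α := fun _ : Fin M => Vec M × Vec M)
    (fun i => if i = e k then (userLaw M n).map (fun p => (p.1, quantize p.1 p.2))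
      else (Measure.dirac 0).prod (isotropicLaw M)) e
  simp only [e.injective.eq_iff] at hmp
  change MeasurePreserving _ (reducedLaw M n k) (reducedLaw M n (e k)) at hmp
  rw [← hmp.integral_comp']
  congr 1
  ext x
  have hx (i : Fin M) :
      MeasurableEquiv.piCongrLeft (fun _ : Fin M => Vec M × Vec M) e x (e i) = x i := by
    rw [MeasurableEquiv.coe_piCongrLeft]
    exact Equiv.piCongrLeft_apply_apply (P := fun _ => Vec M × Vec M) e x i
  rw [← rateOf_comp_equiv e]
  simp_rw [hx]

/-- Two users with the same feedback size and path loss have the same average rate. -/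
theorem integral_instRate_congr {M : ℕ} [NeZero M] (g P : ℝ) {b b' : Fin M → ℕ} {k k' : Fin M}
    (h : b k = b' k') :
    ∫ ω, instRate g P k ω ∂law M b = ∫ ω, instRate g P k' ω ∂law M b' := by
  rw [integral_instRate, integral_instRate, integral_rateOf_reducedLaw_perm (Equiv.swap k k'),
    Equiv.swap_apply_left]
  simp_rw [h]

/-! ### The instantaneous rate in terms of the four reduced variables -/

/-- The beamforming vector of another stream is orthogonal to the quantized channel. -/
theorem inner_quantChan_beam {M : ℕ} {b : Fin M → ℕ} (ω : Sample M b) {i k : Fin M} (h : i ≠ k) :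
    inner ℂ (quantChan k ω) (beam i ω) = 0 := by
  have hcol : inner ℂ (quantChan k ω) (WithLp.toLp 2 fun j => (quantMatrix ω)⁻¹ j i)
      = (quantMatrix ω * (quantMatrix ω)⁻¹) k i := by
    simp [PiLp.inner_apply, Matrix.mul_apply, quantMatrix, mul_comm]
  rw [beam, normalize, inner_smul_right, hcol]
  -- In the singular case the inverse, hence the beam, is `0`, so almost sure invertibility is not
  -- needed.
  by_cases hdet : IsUnit (quantMatrix ω).det
  · rw [Matrix.mul_nonsing_inv _ hdet, Matrix.one_apply_ne h.symm, mul_zero]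
  · rw [Matrix.nonsing_inv_apply_not_isUnit _ hdet]
    simp

theorem norm_inner_normalize_sq {M : ℕ} (x v : Vec M) :
    ‖inner ℂ x v‖ ^ 2 = ‖x‖ ^ 2 * ‖inner ℂ (normalize x) v‖ ^ 2 := by
  rcases eq_or_ne x 0 with rfl | hx
  · simp
  · have : ‖x‖ ≠ 0 := norm_ne_zero_iff.2 hx
    rw [normalize, inner_smul_left, norm_mul]
    simp only [Complex.conj_ofReal, Complex.norm_real, norm_inv, norm_norm]
    field_simp

/-- Pythagoras; this makes `Z` the squared length of the error component. -/
theorem norm_sub_projection_sq {M : ℕ} {u w : Vec M} (hu : ‖u‖ = 1) (hw : ‖w‖ = 1) :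
    ‖u - inner ℂ w u • w‖ ^ 2 = 1 - ‖inner ℂ u w‖ ^ 2 := by
  have horth : inner ℂ (u - inner ℂ w u • w) (inner ℂ w u • w) = 0 := by
    rw [inner_smul_right, inner_sub_left, inner_smul_left, inner_self_eq_norm_sq_to_K, hw,
      inner_conj_symm]
    simp
  have h := norm_add_sq_eq_norm_sq_add_norm_sq_of_inner_eq_zero _ _ horth
  rw [sub_add_cancel, norm_smul, hu, hw, norm_inner_symm w u] at h
  linarith

theorem norm_inner_chan_beam_sq {M : ℕ} {b : Fin M → ℕ} {ω : Sample M b} {i k : Fin M}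
    (hik : i ≠ k) (hq : ‖quantChan k ω‖ = 1) :
    ‖inner ℂ (chan k ω) (beam i ω)‖ ^ 2 =
      Q k ω * (‖inner ℂ (errDir k ω) (beam i ω)‖ ^ 2 * Z k ω) := by
  rcases eq_or_ne (chan k ω) 0 with h0 | h0
  · simp [Q, h0]
  -- `norm_inner_normalize_sq` is used for the channel and again, reversed, for the error component;
  -- it also covers a vanishing error. Orthogonality to the quantized channel removes the remaining
  -- term.
  rw [norm_inner_normalize_sq, Q, Z, errDir, chanDir,
    ← norm_sub_projection_sq (norm_normalize_of_ne_zero h0) hq,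
    mul_comm (‖inner ℂ (normalize (_ - _)) _‖ ^ 2), ← norm_inner_normalize_sq (_ - _),
    inner_sub_left, inner_smul_left, inner_quantChan_beam ω hik]
  simp

theorem instRate_eq_reducedRate {M : ℕ} {b : Fin M → ℕ} (g P : ℝ) {ω : Sample M b} {k : Fin M}
    (hq : ‖quantChan k ω‖ = 1) : instRate g P k ω = reducedRate (g * P) k ω := by
  have h1 : ∑ i ∈ Finset.univ.erase k, (g * P / M) * ‖inner ℂ (chan k ω) (beam i ω)‖ ^ 2
      = (g * P / M) * Q k ω * W k ω * Z k ω := by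
    rw [W, Finset.mul_sum, Finset.sum_mul]
    refine Finset.sum_congr rfl fun i hi => ?_
    rw [norm_inner_chan_beam_sq (Finset.ne_of_mem_erase hi) hq]
    ring
  rw [instRate, reducedRate, h1, norm_inner_normalize_sq, ← mul_assoc]
  rfl

theorem instRate_ae_eq_reducedRate {M : ℕ} [NeZero M] (g P : ℝ) (b : Fin M → ℕ) (k : Fin M) :
    instRate g P k =ᵐ[law M b] reducedRate (g * P) k := by
  filter_upwards [law_ae_norm_quantChan b k] with ω hω using instRate_eq_reducedRate g P hω

theorem integral_instRate_eq_integral_reducedRate {M : ℕ} [NeZero M] (g P : ℝ) {b b' : Fin M → ℕ}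
    {k k' : Fin M} (h : b k = b' k') :
    ∫ ω, instRate g P k ω ∂law M b = ∫ ω, reducedRate (g * P) k' ω ∂law M b' :=
  (integral_instRate_congr g P h).trans (integral_congr_ae (instRate_ae_eq_reducedRate g P b' k'))

theorem integral_reducedRate_congr {M : ℕ} [NeZero M] (P : ℝ) {b b' : Fin M → ℕ} {k k' : Fin M}
    (h : b k = b' k') :
    ∫ ω, reducedRate P k ω ∂law M b = ∫ ω, reducedRate P k' ω ∂law M b' := by
  have h1 := integral_instRate_eq_integral_reducedRate 1 P (b := b) (rfl : b k = b k)
  have h2 := integral_instRate_eq_integral_reducedRate 1 P h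
  rw [one_mul] at h1 h2
  exact h1.symm.trans h2

theorem integrable_reducedRate {M : ℕ} [NeZero M] {P : ℝ} (hP : 0 ≤ P) (b : Fin M → ℕ)
    (k : Fin M) : Integrable (reducedRate P k) (law M b) := by
  have h := instRate_ae_eq_reducedRate 1 P b k
  rw [one_mul] at h
  exact (integrable_instRate zero_le_one hP b k).congr h

end ZFMIMO

end

theorem lemma2 (M : ℕ) [NeZero M] :
    (∀ (γ : Fin M → ℝ) (P : ℝ), (∀ k, 0 ≤ γ k) → 0 ≤ P → ∀ (b : Fin M → ℕ) (k : Fin M),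
      MeasureTheory.Integrable (ZFMIMO.instRate (γ k) P k) (ZFMIMO.law M b) ∧
      ∀ b' : Fin M → ℕ, b' k = b k → ZFMIMO.userRate γ P b' k = ZFMIMO.userRate γ P b k) ∧
    ∃ R : ℝ → ℕ → ℝ,
      (∀ (P : ℝ), 0 ≤ P → ∀ (b : Fin M → ℕ) (k : Fin M),
        MeasureTheory.Integrable (ZFMIMO.reducedRate P k) (ZFMIMO.law M b) ∧
        R P (b k) = ∫ ω, ZFMIMO.reducedRate P k ω ∂(ZFMIMO.law M b) ∧
        ∀ b' : Fin M → ℕ, b' 0 = b k →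
          R P (b k) = ∫ ω, ZFMIMO.reducedRate P 0 ω ∂(ZFMIMO.law M b')) ∧
      (∀ (P : ℝ), 0 ≤ P → ∀ b : Fin M → ℕ,
        (∀ k, ZFMIMO.userRate (fun _ => 1) P b k = R P (b k)) ∧
        ZFMIMO.sumRate (fun _ => 1) P b = ∑ k, R P (b k)) ∧
      (∀ (γ : Fin M → ℝ) (P : ℝ), (∀ k, 0 ≤ γ k) → 0 ≤ P → ∀ b : Fin M → ℕ,
        (∀ k, ZFMIMO.userRate γ P b k = R (γ k * P) (b k)) ∧
        ZFMIMO.sumRate γ P b = ∑ k, R (γ k * P) (b k)) := by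
  have hrate (γ : Fin M → ℝ) (P : ℝ) (b : Fin M → ℕ) (k : Fin M) :
      ZFMIMO.userRate γ P b k =
        ∫ ω, ZFMIMO.reducedRate (γ k * P) 0 ω ∂(ZFMIMO.law M fun _ => b k) :=
    ZFMIMO.integral_instRate_eq_integral_reducedRate (γ k) P rfl
  refine ⟨fun γ P hγ hP b k => ⟨ZFMIMO.integrable_instRate (hγ k) hP b k,
    fun b' hb => ZFMIMO.integral_instRate_congr (γ k) P hb⟩,
    -- The common rate function is read off at user `0` when all users have feedback size `n`; any
    -- other system in which that user has size `n` would give the same value.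
    fun P n => ∫ ω, ZFMIMO.reducedRate P 0 ω ∂(ZFMIMO.law M fun _ => n), ?_, ?_, ?_⟩
  · exact fun P hP b k => ⟨ZFMIMO.integrable_reducedRate hP b k,
      ZFMIMO.integral_reducedRate_congr P rfl,
      fun b' hb => ZFMIMO.integral_reducedRate_congr P hb.symm⟩
  · intro P _ b
    have h (k : Fin M) := hrate (fun _ => 1) P b k
    simp only [one_mul] at h
    exact ⟨h, Finset.sum_congr rfl fun k _ => h k⟩
  · exact fun γ P _ _ b => ⟨hrate γ P b, Finset.sum_congr rfl fun k _ => hrate γ P b k⟩
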